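/- Let $k$ be a field. For every integer $a \ge 9$ there is a numerical semigroup $H$ (a submonoid of $(\mathbb N,+)$ whose elements have greatest common divisor $1$) such that the numerical semigroup ring $R = k[[H]]$, i.e. the subring of $k[[t]]$ consisting of the power series all of whose exponents lie in $H$, has multiplicity $e(R) = a$ and has a nontrivial semidualizing module. Here a finitely generated $R$-module $C$ is semidualizing if the homothety map $R \to \operatorname{Hom}_R(C,C)$ is an isomorphism and $\operatorname{Ext}^i_R(C,C) = 0$ for all $i > 0$, and it is nontrivial if it is isomorphic neither to $R$ nor to the canonical module of $R$. -/

import Mathlib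

open CategoryTheory

universe u

/-- A numerical semigroup: a submonoid of `ℕ` whose elements have greatest common divisor `1`. -/
def IsNumericalSemigroup (H : AddSubmonoid ℕ) : Prop :=
  ∀ d : ℕ, (∀ h ∈ H, d ∣ h) → d = 1

/-- The ring `k⟦H⟧`: the subring of `k⟦t⟧` of all power series whose exponents lie in `H`.
If `H` is generated by `a₁, …, aₗ`, then this is `k⟦t^a₁, …, t^aₗ⟧`. -/
def semigroupRing (k : Type u) [Field k] (H : AddSubmonoid ℕ) :
    Subalgebra k (PowerSeries k) where
  carrier := {f | ∀ n, PowerSeries.coeff n f ≠ 0 → n ∈ H}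
  mul_mem' {f g} hf hg n hn := by
    rw [PowerSeries.coeff_mul] at hn
    obtain ⟨p, hp, hne⟩ := Finset.exists_ne_zero_of_sum_ne_zero hn
    rw [← Finset.HasAntidiagonal.mem_antidiagonal.mp hp]
    exact H.add_mem (hf _ (left_ne_zero_of_mul hne)) (hg _ (right_ne_zero_of_mul hne))
  add_mem' {f g} hf hg n hn := by
    rw [map_add] at hn
    by_cases h : PowerSeries.coeff n f = 0
    · exact hg n fun h' => hn (by rw [h, h', add_zero])
    · exact hf n h
  algebraMap_mem' r n hn := by
    rw [PowerSeries.algebraMap_apply, PowerSeries.coeff_C] at hn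
    by_cases h : n = 0
    · rw [h]; exact H.zero_mem
    · simp [h] at hn

theorem semigroupRing_inv_mem (k : Type u) [Field k] (H : AddSubmonoid ℕ) {f : PowerSeries k}
    (hf : f ∈ semigroupRing k H) : f⁻¹ ∈ semigroupRing k H := by
  intro n
  induction n using Nat.strong_induction_on with
  | _ n ih =>
    intro hn
    rw [PowerSeries.coeff_inv] at hn
    by_cases h0 : n = 0
    · rw [h0]; exact H.zero_mem
    · rw [if_neg h0] at hn
      obtain ⟨p, hp, hne⟩ := Finset.exists_ne_zero_of_sum_ne_zero (right_ne_zero_of_mul hn)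
      by_cases hlt : p.2 < n
      · rw [if_pos hlt] at hne
        rw [← Finset.HasAntidiagonal.mem_antidiagonal.mp hp]
        exact H.add_mem (hf _ (left_ne_zero_of_mul hne)) (ih _ hlt (right_ne_zero_of_mul hne))
      · rw [if_neg hlt] at hne
        exact absurd rfl hne

theorem semigroupRing_isUnit (k : Type u) [Field k] (H : AddSubmonoid ℕ)
    (f : semigroupRing k H) (hf : PowerSeries.constantCoeff (f : PowerSeries k) ≠ 0) :
    IsUnit f :=
  IsUnit.of_mul_eq_one ⟨_, semigroupRing_inv_mem k H f.2⟩
    (Subtype.ext (PowerSeries.mul_inv_cancel _ hf))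

instance semigroupRing_isLocalRing (k : Type u) [Field k] (H : AddSubmonoid ℕ) :
    IsLocalRing (semigroupRing k H) :=
  IsLocalRing.of_isUnit_or_isUnit_one_sub_self fun f => by
    by_cases hf : PowerSeries.constantCoeff (f : PowerSeries k) = 0
    · refine Or.inr (semigroupRing_isUnit k H _ ?_)
      simp [hf]
    · exact Or.inl (semigroupRing_isUnit k H f hf)

/-- The Noetherian local ring `(R, 𝔪)` has (Hilbert–Samuel) multiplicity `e`: if `d = dim R`, then
`e = lim d! · ℓ(R / 𝔪ⁿ) / nᵈ` as `n → ∞`. -/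
def HasMultiplicity (R : Type u) [CommRing R] [IsLocalRing R] (e : ℕ) : Prop :=
  ∃ d : ℕ, ringKrullDim R = d ∧
    Filter.Tendsto
      (fun n : ℕ =>
        (d.factorial : ℝ) *
          ((Module.length R (R ⧸ IsLocalRing.maximalIdeal R ^ n)).toNat : ℝ) / (n : ℝ) ^ d)
      Filter.atTop (nhds (e : ℝ))

/-- `C` is a semidualizing `R`-module: it is finitely generated, the homothety map
`R → Hom_R(C, C)` is bijective, and `Ext^i_R(C, C) = 0` for all `i > 0`. -/
structure IsSemidualizing (R : Type u) [CommRing R] (C : Type u) [AddCommGroup C] [Module R C] :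
    Prop where
  finite : Module.Finite R C
  homothety_bijective :
    Function.Bijective (LinearMap.lsmul R C : R →ₗ[R] (C →ₗ[R] C))
  ext_eq_zero : ∀ i : ℕ, 0 < i →
    Subsingleton (Abelian.Ext (ModuleCat.of R C) (ModuleCat.of R C) i)

/-- `K` is a canonical module of the Cohen–Macaulay local ring `R` with residue field `κ`: a
maximal Cohen–Macaulay module of type one and of finite injective dimension. With `d = dim R`,
the first two properties say that `K` is finitely generated, that `Ext^i_R(κ, K) = 0` for
`i < d`, and that `Ext^d_R(κ, K)` is a one-dimensional `κ`-vector space. -/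
def IsCanonicalModule (R : Type u) [CommRing R] [IsLocalRing R]
    (K : Type u) [AddCommGroup K] [Module R K] : Prop :=
  Module.Finite R K ∧
  (∃ d : ℕ, ringKrullDim R = d ∧
    (∀ i < d, Subsingleton
      (Abelian.Ext (ModuleCat.of R (IsLocalRing.ResidueField R)) (ModuleCat.of R K) i)) ∧
    Nonempty
      (Abelian.Ext (ModuleCat.of R (IsLocalRing.ResidueField R)) (ModuleCat.of R K) d
        ≃ₗ[R] IsLocalRing.ResidueField R)) ∧
  ∃ n : ℕ, HasInjectiveDimensionLT (ModuleCat.of R K) n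

/-- `R` has a nontrivial semidualizing module: one that is isomorphic neither to `R` nor to the
canonical module of `R` (which is unique up to isomorphism). -/
def HasNontrivialSemidualizingModule (R : Type u) [CommRing R] [IsLocalRing R] : Prop :=
  ∃ (C : Type u) (_ : AddCommGroup C) (_ : Module R C),
    IsSemidualizing R C ∧
    ¬ Nonempty (C ≃ₗ[R] R) ∧
    ∀ (K : Type u) [AddCommGroup K] [Module R K],
      IsCanonicalModule R K → ¬ Nonempty (C ≃ₗ[R] K)

/-! Put u = t^p and A = k⟦u³, u⁴, u⁵⟧. The ring A has type 2 and canonical module A + uA. Choose H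
so that its part in each residue class r modulo p is r + p(m(r) + ⟨3, 4, 5⟩). Then R = k⟦H⟧ is free
over A on the monomials t^(r + p m(r)), and C = R + t^p R is the base change of the canonical module
of A, hence semidualizing. It is not R because t^p ∉ R, and it is not canonical as soon as the fibre
R/𝔪_A R has two independent socle monomials. What remains is to find m compatible with addition and
with least nonzero element a.

Base change is replaced by explicit syzygies, with s = p and d = 3p. The first syzygy of C is D = {f
∈ R | t^s f ∈ R}, which equals t^d (R + t^s R + t^(2s) R), the extension of 𝔪_A. The first syzygy of
D in R³ is D ⊕ D (`conductor_exact`). Every map D → C is multiplication by an element of R + t^s R +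
t^(2s) R (`exists_supported_of_linearMap`), and therefore maps into C extend from either syzygy to
the free module (`exists_lift_twoTerm`, `exists_lift_conductor`). So Ext¹(C, C) = Ext¹(D, C) = 0,
and dimension shifting along D ⊕ D kills all higher Ext.

A canonical module has one-dimensional Ext¹(κ, -), while two socle monomials give independent
classes in Ext¹(κ, C). The multiplicity comes from comparing powers of the maximal ideal with the
filtration by order. -/

/-! ### Vanishing of Ext from syzygies and extension of maps -/

section ExtVanishing

variable {R : Type u} [CommRing R] {M N P Y : Type u} [AddCommGroup M] [Module R M]
  [AddCommGroup N] [Module R N] [AddCommGroup P] [Module R P] [AddCommGroup Y] [Module R Y]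

theorem shortExact_of_linearMap {f : M →ₗ[R] N} {g : N →ₗ[R] P}
    (hf : Function.Injective f) (hfg : Function.Exact f g) (hg : Function.Surjective g) :
    ∃ w, (ShortComplex.mk (ModuleCat.ofHom f) (ModuleCat.ofHom g) w).ShortExact := by
  have w : ModuleCat.ofHom f ≫ ModuleCat.ofHom g = 0 := by
    rw [← ModuleCat.ofHom_comp, hfg.linearMap_comp_eq_zero]; rfl
  refine ⟨w, ?_⟩
  have := (ModuleCat.mono_iff_injective (ModuleCat.ofHom f)).2 hf
  have := (ModuleCat.epi_iff_surjective (ModuleCat.ofHom g)).2 hg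
  exact ShortComplex.ShortExact.mk
    ((ShortComplex.ShortExact.moduleCat_exact_iff_function_exact _).2 hfg)

theorem ext_one_subsingleton_of_forall_lift [Module.Projective R N] {f : M →ₗ[R] N}
    {g : N →ₗ[R] P} (hf : Function.Injective f) (hfg : Function.Exact f g)
    (hg : Function.Surjective g) (h : ∀ φ : M →ₗ[R] Y, ∃ ψ : N →ₗ[R] Y, ψ ∘ₗ f = φ) :
    Subsingleton (Abelian.Ext (ModuleCat.of R P) (ModuleCat.of R Y) 1) := by
  obtain ⟨w, hS⟩ := shortExact_of_linearMap hf hfg hg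
  refine subsingleton_of_forall_eq 0 fun x => ?_
  have hP : Projective (ModuleCat.of R N) := (IsProjective.iff_projective N).1 inferInstance
  obtain ⟨y, hy⟩ := Abelian.Ext.contravariant_sequence_exact₃ hS _ x
    (Abelian.Ext.eq_zero_of_projective _) (n₀ := 0) rfl
  obtain ⟨φ, rfl⟩ := Abelian.Ext.mk₀_bijective _ _ |>.2 y
  obtain ⟨ψ, hψ⟩ := h φ.hom
  have hφ : φ = ModuleCat.ofHom f ≫ ModuleCat.ofHom ψ := by
    ext m; exact (LinearMap.congr_fun hψ m).symm
  rw [← hy, hφ, ← Abelian.Ext.mk₀_comp_mk₀]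
  exact hS.extClass_comp_assoc _

theorem ext_succ_subsingleton [Module.Projective R N] {f : M →ₗ[R] N}
    {g : N →ₗ[R] P} (hf : Function.Injective f) (hfg : Function.Exact f g)
    (hg : Function.Surjective g) (n : ℕ)
    (h : Subsingleton (Abelian.Ext (ModuleCat.of R M) (ModuleCat.of R Y) n)) :
    Subsingleton (Abelian.Ext (ModuleCat.of R P) (ModuleCat.of R Y) (n + 1)) := by
  obtain ⟨w, hS⟩ := shortExact_of_linearMap hf hfg hg
  refine subsingleton_of_forall_eq 0 fun x => ?_
  have hP : Projective (ModuleCat.of R N) := (IsProjective.iff_projective N).1 inferInstance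
  obtain ⟨y, hy⟩ := Abelian.Ext.contravariant_sequence_exact₃ hS _ x
    (Abelian.Ext.eq_zero_of_projective _) (n₀ := n) (add_comm 1 n)
  rw [← hy, show y = 0 from h.elim _ _, Abelian.Ext.comp_zero]

theorem ext_prod_subsingleton (n : ℕ)
    (hM : Subsingleton (Abelian.Ext (ModuleCat.of R M) (ModuleCat.of R Y) n))
    (hN : Subsingleton (Abelian.Ext (ModuleCat.of R N) (ModuleCat.of R Y) n)) :
    Subsingleton (Abelian.Ext (ModuleCat.of R (M × N)) (ModuleCat.of R Y) n) := by
  obtain ⟨w, hS⟩ := shortExact_of_linearMap (LinearMap.inl_injective (R := R) (M := M) (M₂ := N))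
    Function.Exact.inl_snd LinearMap.snd_surjective
  refine subsingleton_of_forall_eq 0 fun x => ?_
  obtain ⟨y, hy⟩ := Abelian.Ext.contravariant_sequence_exact₂ hS _ x (hM.elim _ _)
  rw [← hy, show y = 0 from hN.elim _ _, Abelian.Ext.comp_zero]

/-- When a module is covered by a projective with kernel two copies of itself, vanishing of Ext¹
propagates to all degrees by dimension shifting. -/
theorem ext_succ_subsingleton_of_syzygy_prod_self [Module.Projective R N]
    {f : P × P →ₗ[R] N} {g : N →ₗ[R] P} (hf : Function.Injective f)
    (hfg : Function.Exact f g) (hg : Function.Surjective g)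
    (h : ∀ φ : P × P →ₗ[R] Y, ∃ ψ : N →ₗ[R] Y, ψ ∘ₗ f = φ) (n : ℕ) :
    Subsingleton (Abelian.Ext (ModuleCat.of R P) (ModuleCat.of R Y) (n + 1)) := by
  induction n with
  | zero => exact ext_one_subsingleton_of_forall_lift hf hfg hg h
  | succ n ih => exact ext_succ_subsingleton hf hfg hg _ (ext_prod_subsingleton _ ih ih)

theorem ext_subsingleton_of_forall_lift [Module.Projective R N]
    {f : M →ₗ[R] N} {g : N →ₗ[R] P} (hf : Function.Injective f)
    (hfg : Function.Exact f g) (hg : Function.Surjective g)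
    (h : ∀ φ : M →ₗ[R] Y, ∃ ψ : N →ₗ[R] Y, ψ ∘ₗ f = φ)
    (hM : ∀ n : ℕ, Subsingleton (Abelian.Ext (ModuleCat.of R M) (ModuleCat.of R Y) (n + 1))) :
    ∀ n : ℕ, 0 < n → Subsingleton (Abelian.Ext (ModuleCat.of R P) (ModuleCat.of R Y) n)
  | 1, _ => ext_one_subsingleton_of_forall_lift hf hfg hg h
  | n + 2, _ => ext_succ_subsingleton hf hfg hg _ (hM n)

theorem exists_ext_one_connecting {f : M →ₗ[R] N}
    {g : N →ₗ[R] P} (hf : Function.Injective f) (hfg : Function.Exact f g)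
    (hg : Function.Surjective g) :
    ∃ δ : (M →ₗ[R] Y) →ₗ[R] Abelian.Ext (ModuleCat.of R P) (ModuleCat.of R Y) 1,
      ∀ φ, δ φ = 0 → ∃ ψ : N →ₗ[R] Y, ψ ∘ₗ f = φ := by
  obtain ⟨w, hS⟩ := shortExact_of_linearMap hf hfg hg
  refine ⟨{ toFun := fun φ => hS.extClass.comp (Abelian.Ext.mk₀ (ModuleCat.ofHom φ)) rfl
            map_add' := fun φ φ' => ?_
            map_smul' := fun r φ => ?_ }, fun φ h => ?_⟩
  · rw [show ModuleCat.ofHom (φ + φ') = ModuleCat.ofHom φ + ModuleCat.ofHom φ' from rfl,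
      Abelian.Ext.mk₀_add, Abelian.Ext.comp_add]
  · rw [RingHom.id_apply, show ModuleCat.ofHom (r • φ) = r • ModuleCat.ofHom φ from rfl,
      Abelian.Ext.mk₀_smul, Abelian.Ext.comp_smul]
  · obtain ⟨y, hy⟩ := Abelian.Ext.contravariant_sequence_exact₁ hS _
      (Abelian.Ext.mk₀ (ModuleCat.ofHom φ)) (add_zero 1) h
    obtain ⟨ψ, rfl⟩ := Abelian.Ext.mk₀_bijective _ _ |>.2 y
    rw [Abelian.Ext.mk₀_comp_mk₀] at hy
    refine ⟨ψ.hom, ?_⟩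
    have := (Abelian.Ext.mk₀_bijective _ _).1 hy
    exact congrArg ModuleCat.Hom.hom this

/-- If `Ext¹(κ, Y)` is one-dimensional, then any two linear maps `𝔪 → Y` have a linear combination
with coefficients not all in `𝔪` which extends to the ring. -/
theorem exists_extension_of_ext_one_residueField [IsLocalRing R]
    (e : Abelian.Ext (ModuleCat.of R (IsLocalRing.ResidueField R)) (ModuleCat.of R Y) 1
      ≃ₗ[R] IsLocalRing.ResidueField R)
    (φ₁ φ₂ : IsLocalRing.maximalIdeal R →ₗ[R] Y) :
    ∃ a b : R, (a ∉ IsLocalRing.maximalIdeal R ∨ b ∉ IsLocalRing.maximalIdeal R) ∧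
      ∃ y : Y, ∀ x : IsLocalRing.maximalIdeal R, (x : R) • y = a • φ₁ x + b • φ₂ x := by
  obtain ⟨δ, hδ⟩ := exists_ext_one_connecting (R := R) (Y := Y)
    (f := (IsLocalRing.maximalIdeal R).subtype)
    (g := Algebra.linearMap R (IsLocalRing.ResidueField R)) (Submodule.subtype_injective _)
    (fun x => by
      rw [Algebra.linearMap_apply, IsLocalRing.ResidueField.algebraMap_eq,
        IsLocalRing.residue_eq_zero_iff]
      simp)
    IsLocalRing.residue_surjective
  obtain ⟨x₁, hx₁⟩ := IsLocalRing.residue_surjective (e (δ φ₁))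
  obtain ⟨x₂, hx₂⟩ := IsLocalRing.residue_surjective (e (δ φ₂))
  obtain ⟨a, b, hab, h0⟩ : ∃ a b : R,
      (a ∉ IsLocalRing.maximalIdeal R ∨ b ∉ IsLocalRing.maximalIdeal R) ∧
      IsLocalRing.residue R (a * x₁ + b * x₂) = 0 := by
    -- Two vectors on a line are dependent: (1, 0) is a relation if the first vanishes, and (-x₂,
    -- x₁) is one with a unit coefficient otherwise.
    by_cases hx : x₁ ∈ IsLocalRing.maximalIdeal R
    · refine ⟨1, 0, Or.inl ?_, ?_⟩
      · exact fun h => (IsLocalRing.mem_maximalIdeal _).1 h isUnit_one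
      · rwa [one_mul, zero_mul, add_zero, IsLocalRing.residue_eq_zero_iff]
    · refine ⟨-x₂, x₁, Or.inr hx, ?_⟩
      rw [show -x₂ * x₁ + x₁ * x₂ = 0 by ring, map_zero]
  have hδ0 : δ (a • φ₁ + b • φ₂) = 0 := by
    apply e.injective
    rw [map_add, map_smul, map_smul, map_add, map_smul, map_smul, map_zero, ← hx₁, ← hx₂, ← h0,
      map_add, map_mul, map_mul]
    rfl
  obtain ⟨ψ, hψ⟩ := hδ _ hδ0
  refine ⟨a, b, hab, ψ 1, fun x => ?_⟩
  rw [← map_smul, smul_eq_mul, mul_one]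
  exact LinearMap.congr_fun hψ x

end ExtVanishing

/-! ### Power series with prescribed exponents -/

section Supported

variable {k : Type u} [Field k]

/-- All exponents of the power series `f` lie in `T`. -/
def PowerSeries.Supported (T : Set ℕ) (f : PowerSeries k) : Prop :=
  ∀ n, PowerSeries.coeff n f ≠ 0 → n ∈ T

namespace PowerSeries

variable {T T₁ T₂ : Set ℕ} {f g : PowerSeries k}

theorem Supported.mono (hf : Supported T₁ f) (h : ∀ n ∈ T₁, n ∈ T₂) : Supported T₂ f :=
  fun n hn => h n (hf n hn)

theorem Supported.coeff_eq_zero (hf : Supported T f) {n : ℕ} (hn : n ∉ T) : coeff n f = 0 :=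
  by_contra fun h => hn (hf n h)

theorem Supported.add (hf : Supported T f) (hg : Supported T g) : Supported T (f + g) := by
  intro n hn
  by_cases h : coeff n f = 0
  · exact hg n fun h' => hn (by rw [map_add, h, h', add_zero])
  · exact hf n h

theorem supported_X_pow_mul_iff (s : ℕ) :
    Supported T (X ^ s * f) ↔ Supported {n | n + s ∈ T} f := by
  refine ⟨fun h n hn => h (n + s) (by rwa [coeff_X_pow_mul]), fun h n hn => ?_⟩
  rw [coeff_X_pow_mul'] at hn
  split_ifs at hn with hs
  · simpa [Nat.sub_add_cancel hs] using h _ hn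
  · exact absurd rfl hn

theorem supported_X_pow {n : ℕ} (hn : n ∈ T) : Supported T (X ^ n : PowerSeries k) := by
  intro m hm
  rw [coeff_X_pow] at hm
  split_ifs at hm with h
  · exact h ▸ hn
  · exact absurd rfl hm

theorem Supported.mul (hf : Supported T₁ f) (hg : Supported T₂ g)
    (h : ∀ m ∈ T₁, ∀ n ∈ T₂, m + n ∈ T) : Supported T (f * g) := by
  intro n hn
  rw [coeff_mul] at hn
  obtain ⟨p, hp, hne⟩ := Finset.exists_ne_zero_of_sum_ne_zero hn
  rw [← Finset.HasAntidiagonal.mem_antidiagonal.mp hp]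
  exact h _ (hf _ (left_ne_zero_of_mul hne)) _ (hg _ (right_ne_zero_of_mul hne))

theorem Supported.exists_eq_add (hf : Supported T f) {s : ℕ}
    (h : ∀ n ∈ T, n ∈ T₁ ∨ ∃ m ∈ T₂, n = m + s) :
    ∃ g₁ g₂ : PowerSeries k, Supported T₁ g₁ ∧ Supported T₂ g₂ ∧ f = g₁ + X ^ s * g₂ := by
  classical
  -- Exponents in both sets are assigned to the first summand only, so nothing is counted twice.
  refine ⟨mk fun n => if n ∈ T₁ then coeff n f else 0,
    mk fun n => if n + s ∈ T₁ then 0 else coeff (n + s) f, ?_, ?_, ?_⟩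
  · intro n hn
    by_contra h'
    simp [h'] at hn
  · intro n hn
    rw [coeff_mk] at hn
    split_ifs at hn with h'
    · exact absurd rfl hn
    · obtain h'' | ⟨m, hm, hmn⟩ := h _ (hf _ hn)
      · exact absurd h'' h'
      · rwa [Nat.add_right_cancel hmn]
  · ext n
    rw [map_add, coeff_mk, coeff_X_pow_mul']
    by_cases h0 : coeff n f = 0
    · by_cases hs : s ≤ n <;> simp [h0, hs]
    · by_cases h' : n ∈ T₁
      · by_cases hs : s ≤ n <;> simp [h', hs]
      · obtain h'' | ⟨m, hm, rfl⟩ := h _ (hf _ h0)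
        · exact absurd h'' h'
        · simp [h']

end PowerSeries

end Supported

open PowerSeries

/-! ### Monomial modules and their homomorphisms -/

section ExpModule

variable (k : Type u) [Field k] (H : AddSubmonoid ℕ)

/-- The fractional monomial ideal of `k⟦H⟧` of all power series whose exponents lie in the
relative ideal `T` of `H`. -/
def monomialModule (T : Set ℕ) (hT : ∀ h ∈ H, ∀ t ∈ T, h + t ∈ T) :
    Submodule (semigroupRing k H) (PowerSeries k) where
  carrier := {f | Supported T f}
  add_mem' hf hg := hf.add hg
  zero_mem' _ hn := absurd (map_zero _) hn
  smul_mem' r _ hf := Supported.mul (T₁ := H) r.2 hf hT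

variable {k H}

theorem X_pow_mem_semigroupRing {n : ℕ} (hn : n ∈ H) : (X ^ n : PowerSeries k) ∈ semigroupRing k H :=
  supported_X_pow (T := H) hn

/-- Linear maps between submodules of `k⟦t⟧` are multiplications by fractions. -/
theorem linearMap_cross_mul {c : ℕ} (hc : ∀ n, c ≤ n → n ∈ H)
    {M N : Submodule (semigroupRing k H) (PowerSeries k)} (φ : M →ₗ[semigroupRing k H] N)
    (x y : M) :
    (φ x : PowerSeries k) * (y : PowerSeries k) = (φ y : PowerSeries k) * (x : PowerSeries k) := by
  -- Multiplication by t^c clears denominators: t^c x and t^c y become scalars, and (t^c y) • x =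
  -- (t^c x) • y.
  have hmem (f : PowerSeries k) : X ^ c * f ∈ semigroupRing k H :=
    (supported_X_pow_mul_iff (T := H) c).2 fun n _ => hc _ (Nat.le_add_left c n)
  have hxy : (⟨_, hmem (y : PowerSeries k)⟩ : semigroupRing k H) • x =
      (⟨_, hmem (x : PowerSeries k)⟩ : semigroupRing k H) • y := by
    apply Subtype.ext
    change (X ^ c * (y : PowerSeries k)) * (x : PowerSeries k) =
      (X ^ c * (x : PowerSeries k)) * (y : PowerSeries k)
    ring
  have h := congrArg Subtype.val (congrArg φ hxy)
  rw [map_smul, map_smul] at h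
  change (X ^ c * (y : PowerSeries k)) * (φ x : PowerSeries k) =
    (X ^ c * (x : PowerSeries k)) * (φ y : PowerSeries k) at h
  refine mul_left_cancel₀ (pow_ne_zero c (X_ne_zero (R := k))) ?_
  linear_combination h

end ExpModule

/-- The exponents of `R + t ^ s R`. -/
def twoTermSet (H : AddSubmonoid ℕ) (s : ℕ) : Set ℕ := {n | n ∈ H ∨ ∃ h ∈ H, n = h + s}

/-- The exponents of `R + t ^ s R + t ^ (2 * s) R`. -/
def threeTermSet (H : AddSubmonoid ℕ) (s : ℕ) : Set ℕ :=
  {n | n ∈ H ∨ ∃ h ∈ twoTermSet H s, n = h + s}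

/-- The exponents of the conductor ideal `{f ∈ R | t ^ s f ∈ R}`. -/
def conductorSet (H : AddSubmonoid ℕ) (s : ℕ) : Set ℕ := {n | n ∈ H ∧ n + s ∈ H}

/-- Combinatorial conditions on a numerical semigroup `H` which ensure that
`k⟦H⟧ + t ^ s k⟦H⟧` is a semidualizing `k⟦H⟧`-module. -/
structure IsSemidualizingShift (H : AddSubmonoid ℕ) (s d : ℕ) : Prop where
  exists_forall_ge_mem : ∃ c, ∀ n, c ≤ n → n ∈ H
  d_mem : d ∈ H
  d_add_mem : d + s ∈ H
  d_add_two_mul_mem : d + 2 * s ∈ H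
  d_add_three_mul_mem : d + 3 * s ∈ H
  shift_notMem : s ∉ H
  add_mem_of_mem : ∀ n ∈ H, n + 2 * s ∈ H → n + s ∈ H
  exists_of_mem_conductorSet : ∀ n ∈ conductorSet H s, ∃ e ∈ threeTermSet H s, n = e + d
  exists_of_add_mem_twoTermSet : ∀ n ∈ twoTermSet H s, n + s ∈ twoTermSet H s →
    n + 2 * s ∈ twoTermSet H s → ∃ e ∈ threeTermSet H s, n = e + d

/-! ### The module C = R + t^s R and its first syzygy -/

section TwoTermModule

variable (k : Type u) [Field k] (H : AddSubmonoid ℕ) (s : ℕ)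

/-- The `R`-module `R + t ^ s R`, where `R = k⟦H⟧`. -/
def twoTermModule : Submodule (semigroupRing k H) (PowerSeries k) :=
  monomialModule k H (twoTermSet H s) fun h hh t ht => ht.imp (H.add_mem hh)
    fun ⟨h', hh', e⟩ => ⟨h + h', H.add_mem hh hh', by omega⟩

/-- The ideal `{f ∈ R | t ^ s f ∈ R}`, where `R = k⟦H⟧`. -/
def conductorModule : Submodule (semigroupRing k H) (PowerSeries k) :=
  monomialModule k H (conductorSet H s) fun h hh t ht =>
    ⟨H.add_mem hh ht.1, by rw [add_assoc]; exact H.add_mem hh ht.2⟩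

variable {k H s}

theorem mem_twoTermSet {n : ℕ} (hn : n ∈ H) : n ∈ twoTermSet H s := Or.inl hn

theorem add_mem_twoTermSet {n : ℕ} (hn : n ∈ H) : n + s ∈ twoTermSet H s := Or.inr ⟨n, hn, rfl⟩

theorem mem_semigroupRing_of_mem_conductorModule {f : PowerSeries k}
    (hf : f ∈ conductorModule k H s) : f ∈ semigroupRing k H :=
  Supported.mono (T₁ := conductorSet H s) (T₂ := H) hf fun _ h => h.1

theorem X_pow_mul_mem_of_mem_conductorModule {f : PowerSeries k}
    (hf : f ∈ conductorModule k H s) : X ^ s * f ∈ semigroupRing k H :=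
  (supported_X_pow_mul_iff (T := H) s).2 (Supported.mono (T₁ := conductorSet H s) hf fun _ h => h.2)

theorem mem_conductorModule {f : PowerSeries k} (hf : f ∈ semigroupRing k H)
    (hf' : X ^ s * f ∈ semigroupRing k H) : f ∈ conductorModule k H s :=
  fun n hn => ⟨hf n hn, (supported_X_pow_mul_iff (T := H) s).1 hf' n hn⟩

theorem add_X_pow_mul_mem_twoTermModule {f g : PowerSeries k} (hf : f ∈ semigroupRing k H)
    (hg : g ∈ semigroupRing k H) : f + X ^ s * g ∈ twoTermModule k H s :=
  Supported.add (Supported.mono (T₁ := H) hf fun _ => mem_twoTermSet)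
    ((supported_X_pow_mul_iff (T := twoTermSet H s) s).2
      (Supported.mono (T₁ := H) hg fun _ => add_mem_twoTermSet))

theorem mem_twoTermModule_iff {f : PowerSeries k} : f ∈ twoTermModule k H s ↔
    ∃ g ∈ semigroupRing k H, ∃ h ∈ semigroupRing k H, f = g + X ^ s * h := by
  constructor
  · intro hf
    obtain ⟨g, h, hg, hh, rfl⟩ := Supported.exists_eq_add (T := twoTermSet H s) (T₁ := H) (T₂ := H)
      hf fun n hn => hn
    exact ⟨g, hg, h, hh, rfl⟩
  · rintro ⟨g, hg, h, hh, rfl⟩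
    exact add_X_pow_mul_mem_twoTermModule hg hh

theorem Supported.exists_of_threeTermSet {f : PowerSeries k} (hf : Supported (threeTermSet H s) f) :
    ∃ g ∈ semigroupRing k H, ∃ h ∈ twoTermModule k H s, f = g + X ^ s * h := by
  obtain ⟨g, h, hg, hh, rfl⟩ := Supported.exists_eq_add (T₁ := H) (T₂ := twoTermSet H s)
      hf fun n hn => hn
  exact ⟨g, hg, h, hh, rfl⟩

theorem Supported.exists_of_threeTermSet' {f : PowerSeries k}
    (hf : Supported (threeTermSet H s) f) :
    ∃ g ∈ twoTermModule k H s, ∃ h ∈ semigroupRing k H, f = g + X ^ (2 * s) * h := by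
  obtain ⟨g, hg, h, hh, rfl⟩ := Supported.exists_of_threeTermSet hf
  obtain ⟨h₁, hh₁, h₂, hh₂, rfl⟩ := mem_twoTermModule_iff.1 hh
  exact ⟨_, add_X_pow_mul_mem_twoTermModule hg hh₁, h₂, hh₂, by ring⟩

variable (k H s) in
/-- The inclusion of the first syzygy of `R + t ^ s R`. -/
noncomputable def twoTermSyzygy : conductorModule k H s →ₗ[semigroupRing k H]
    semigroupRing k H × semigroupRing k H where
  toFun f := (⟨X ^ s * (f : PowerSeries k), X_pow_mul_mem_of_mem_conductorModule f.2⟩,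
    ⟨-(f : PowerSeries k), neg_mem (mem_semigroupRing_of_mem_conductorModule f.2)⟩)
  map_add' _ _ := Prod.ext (Subtype.ext (mul_add _ _ _)) (Subtype.ext (neg_add _ _))
  map_smul' _ _ := Prod.ext (Subtype.ext (mul_left_comm _ _ _)) (Subtype.ext (mul_neg _ _).symm)

variable (k H s) in
/-- The presentation of `R + t ^ s R`. -/
noncomputable def twoTermPresentation : semigroupRing k H × semigroupRing k H →ₗ[semigroupRing k H]
    twoTermModule k H s where
  toFun p := ⟨(p.1 : PowerSeries k) + X ^ s * (p.2 : PowerSeries k),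
    add_X_pow_mul_mem_twoTermModule p.1.2 p.2.2⟩
  map_add' p q := Subtype.ext (by simp; ring)
  map_smul' r p := Subtype.ext (by simp [Subalgebra.smul_def]; ring)

theorem twoTermSyzygy_injective : Function.Injective (twoTermSyzygy k H s) := fun _ _ h =>
  Subtype.ext (neg_injective (congrArg (fun p => (p.2 : PowerSeries k)) h))

theorem twoTerm_exact :
    Function.Exact (twoTermSyzygy k H s) (twoTermPresentation k H s) := by
  rintro ⟨f, g⟩
  constructor
  · intro h
    have h : (f : PowerSeries k) + X ^ s * (g : PowerSeries k) = 0 := congrArg Subtype.val h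
    have hf : (f : PowerSeries k) = X ^ s * -(g : PowerSeries k) := by linear_combination h
    refine ⟨⟨-g, mem_conductorModule (neg_mem g.2) (hf ▸ f.2)⟩, ?_⟩
    exact Prod.ext (Subtype.ext hf.symm) (Subtype.ext (neg_neg _))
  · rintro ⟨x, hx⟩
    obtain ⟨rfl, rfl⟩ := Prod.mk.inj hx
    apply Subtype.ext
    change X ^ s * (x : PowerSeries k) + X ^ s * -(x : PowerSeries k) = 0
    ring

theorem twoTermPresentation_surjective : Function.Surjective (twoTermPresentation k H s) := by
  rintro ⟨f, hf⟩
  obtain ⟨g, hg, h, hh, rfl⟩ := mem_twoTermModule_iff.1 hf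
  exact ⟨(⟨g, hg⟩, ⟨h, hh⟩), rfl⟩

end TwoTermModule

/-! ### Maps from the conductor ideal D to C, and the syzygy of D -/

namespace IsSemidualizingShift

variable {k : Type u} [Field k] {H : AddSubmonoid ℕ} {s d : ℕ}

/-- The map is multiplication by g / t^d, where g is the image of t^d. Since t^(d+s) and t^(d+2s)
also lie in D, the series g, t^s g and t^(2s) g all lie in C, which forces g to be divisible by t^d
inside the three-term module. -/
theorem exists_supported_of_linearMap (hH : IsSemidualizingShift H s d)
    (φ : conductorModule k H s →ₗ[semigroupRing k H] twoTermModule k H s) :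
    ∃ e : PowerSeries k, Supported (threeTermSet H s) e ∧
      ∀ x, (φ x : PowerSeries k) = e * (x : PowerSeries k) := by
  obtain ⟨c, hc⟩ := hH.exists_forall_ge_mem
  have hX (i : ℕ) (hi : d + i * s ∈ H) (hi' : d + (i + 1) * s ∈ H) :
      (X ^ (d + i * s) : PowerSeries k) ∈ conductorModule k H s :=
    supported_X_pow (T := conductorSet H s) ⟨hi, by rwa [add_assoc, ← Nat.succ_mul]⟩
  have h0 := hX 0 (by simpa using hH.d_mem) (by simpa using hH.d_add_mem)
  have h1 := hX 1 (by simpa using hH.d_add_mem) hH.d_add_two_mul_mem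
  have h2 := hX 2 hH.d_add_two_mul_mem hH.d_add_three_mul_mem
  have hne : (X ^ d : PowerSeries k) ≠ 0 := pow_ne_zero d X_ne_zero
  obtain ⟨g, hg⟩ : ∃ g : twoTermModule k H s, g = φ ⟨_, h0⟩ := ⟨_, rfl⟩
  have key (x : conductorModule k H s) :
      X ^ d * (φ x : PowerSeries k) = (g : PowerSeries k) * (x : PowerSeries k) := by
    have := linearMap_cross_mul hc φ x ⟨_, h0⟩
    rw [← hg] at this
    simp only [zero_mul, add_zero] at this
    linear_combination this
  have k1 : X ^ s * (g : PowerSeries k) = (φ ⟨_, h1⟩ : PowerSeries k) := by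
    refine mul_left_cancel₀ hne ?_
    rw [key]
    dsimp only
    ring
  have k2 : X ^ (2 * s) * (g : PowerSeries k) = (φ ⟨_, h2⟩ : PowerSeries k) := by
    refine mul_left_cancel₀ hne ?_
    rw [key]
    dsimp only
    ring
  have hsupp : Supported {n | ∃ e ∈ threeTermSet H s, n = e + d} (g : PowerSeries k) := by
    intro n hn
    refine hH.exists_of_add_mem_twoTermSet n (g.2 n hn) ?_ ?_
    · exact (supported_X_pow_mul_iff (T := twoTermSet H s) s).1
        (k1 ▸ (φ ⟨_, h1⟩).2) n hn
    · exact (supported_X_pow_mul_iff (T := twoTermSet H s) (2 * s)).1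
        (k2 ▸ (φ ⟨_, h2⟩).2) n hn
  obtain ⟨e₀, e, he₀, he, hge⟩ := Supported.exists_eq_add (T₁ := ∅) (T₂ := threeTermSet H s)
    hsupp fun n hn => Or.inr hn
  have : e₀ = 0 := by
    ext n
    exact he₀.coeff_eq_zero (Set.notMem_empty n)
  refine ⟨e, he, fun x => mul_left_cancel₀ hne ?_⟩
  rw [key, hge, this]
  ring

variable (k) in
theorem X_pow_mul_threeTerm_mem (hH : IsSemidualizingShift H s d) {f g h : PowerSeries k}
    (hf : f ∈ semigroupRing k H) (hg : g ∈ semigroupRing k H) (hh : h ∈ semigroupRing k H) :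
    X ^ d * (f + X ^ s * g + X ^ (2 * s) * h) ∈ conductorModule k H s := by
  have hX {i : ℕ} (hi : i ∈ H) := X_pow_mem_semigroupRing (k := k) hi
  have e1 := hX hH.d_mem
  have e2 := hX hH.d_add_mem
  have e3 := hX hH.d_add_two_mul_mem
  have e4 := hX hH.d_add_three_mul_mem
  apply mem_conductorModule
  · convert add_mem (add_mem (mul_mem e1 hf) (mul_mem e2 hg)) (mul_mem e3 hh) using 1
    ring
  · convert add_mem (add_mem (mul_mem e2 hf) (mul_mem e3 hg)) (mul_mem e4 hh) using 1
    ring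

theorem mem_conductorModule_iff (hH : IsSemidualizingShift H s d) {x : PowerSeries k} :
    x ∈ conductorModule k H s ↔ ∃ f ∈ semigroupRing k H, ∃ g ∈ semigroupRing k H,
      ∃ h ∈ semigroupRing k H, x = X ^ d * (f + X ^ s * g + X ^ (2 * s) * h) := by
  constructor
  · intro hx
    obtain ⟨e₀, e, he₀, he, rfl⟩ := Supported.exists_eq_add (T := conductorSet H s) (T₁ := ∅)
      (T₂ := threeTermSet H s) hx fun n hn => Or.inr (hH.exists_of_mem_conductorSet n hn)
    have : e₀ = 0 := by
      ext n
      exact he₀.coeff_eq_zero (Set.notMem_empty n)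
    obtain ⟨f, hf, g', hg', rfl⟩ := Supported.exists_of_threeTermSet he
    obtain ⟨g, hg, h, hh, rfl⟩ := mem_twoTermModule_iff.1 hg'
    exact ⟨f, hf, g, hg, h, hh, by rw [this]; ring⟩
  · rintro ⟨f, hf, g, hg, h, hh, rfl⟩
    exact hH.X_pow_mul_threeTerm_mem k hf hg hh

variable (k H s) in
/-- The inclusion of the first syzygy of the conductor ideal. -/
noncomputable def _root_.conductorSyzygy :
    conductorModule k H s × conductorModule k H s →ₗ[semigroupRing k H]
      semigroupRing k H × semigroupRing k H × semigroupRing k H where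
  toFun p := (⟨X ^ s * (p.1 : PowerSeries k), X_pow_mul_mem_of_mem_conductorModule p.1.2⟩,
    ⟨X ^ s * (p.2 : PowerSeries k) - (p.1 : PowerSeries k),
      sub_mem (X_pow_mul_mem_of_mem_conductorModule p.2.2)
      (mem_semigroupRing_of_mem_conductorModule p.1.2)⟩,
    ⟨-(p.2 : PowerSeries k), neg_mem (mem_semigroupRing_of_mem_conductorModule p.2.2)⟩)
  map_add' p q := Prod.ext (Subtype.ext (by simp; ring))
    (Prod.ext (Subtype.ext (by simp; ring)) (Subtype.ext (by simp; ring)))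
  map_smul' r p := Prod.ext (Subtype.ext (by simp [Subalgebra.smul_def]; ring))
    (Prod.ext (Subtype.ext (by simp [Subalgebra.smul_def]; ring))
      (Subtype.ext (by simp [Subalgebra.smul_def])))

variable (k) in
/-- The presentation of the conductor ideal. -/
noncomputable def conductorPresentation (hH : IsSemidualizingShift H s d) :
    semigroupRing k H × semigroupRing k H × semigroupRing k H →ₗ[semigroupRing k H]
      conductorModule k H s where
  toFun p := ⟨X ^ d * ((p.1 : PowerSeries k) + X ^ s * (p.2.1 : PowerSeries k)
      + X ^ (2 * s) * (p.2.2 : PowerSeries k)),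
    hH.X_pow_mul_threeTerm_mem k p.1.2 p.2.1.2 p.2.2.2⟩
  map_add' p q := Subtype.ext (by simp; ring)
  map_smul' r p := Subtype.ext (by simp [Subalgebra.smul_def]; ring)

theorem _root_.conductorSyzygy_injective : Function.Injective (conductorSyzygy k H s) := by
  rintro ⟨u, v⟩ ⟨u', v'⟩ h
  have hv : v = v' := Subtype.ext
    (neg_injective (congrArg (fun p => (p.2.2 : PowerSeries k)) h))
  subst hv
  refine Prod.ext (Subtype.ext ?_) rfl
  have := congrArg (fun p => (p.2.1 : PowerSeries k)) h
  exact sub_right_injective this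

/-- In a relation f + t^s g + t^(2s) h = 0, any exponent n of h must be cancelled: n + s occurs in g
or n + 2s occurs in f. Either way n + s ∈ H, so h lies in D, and then so does -t^s h - g. -/
theorem conductor_exact (hH : IsSemidualizingShift H s d) :
    Function.Exact (conductorSyzygy k H s) (hH.conductorPresentation k) := by
  rintro ⟨f, g, h⟩
  constructor
  · intro h0
    have h0 : X ^ d * ((f : PowerSeries k) + X ^ s * (g : PowerSeries k)
      + X ^ (2 * s) * (h : PowerSeries k)) = 0 :=
      congrArg Subtype.val h0
    replace h0 := (mul_eq_zero.1 h0).resolve_left (pow_ne_zero d X_ne_zero)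
    have hhD : -(h : PowerSeries k) ∈ conductorModule k H s := by
      apply neg_mem
      intro n hn
      refine ⟨h.2 n hn, ?_⟩
      have hc : coeff (n + 2 * s) (f : PowerSeries k) + coeff (n + s) (g : PowerSeries k)
          + coeff n (h : PowerSeries k) = 0 := by
        have := congrArg (coeff (n + 2 * s)) h0
        rw [map_add, map_add, coeff_X_pow_mul, show n + 2 * s = n + s + s by ring,
          coeff_X_pow_mul] at this
        rw [show n + 2 * s = n + s + s by ring]
        simpa using this
      by_cases hg : coeff (n + s) (g : PowerSeries k) = 0
      · refine hH.add_mem_of_mem n (h.2 n hn) (f.2 _ fun hf => hn ?_)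
        simpa [hf, hg] using hc
      · exact g.2 _ hg
    have hf : (f : PowerSeries k) = X ^ s * (X ^ s * -(h : PowerSeries k) - (g : PowerSeries k)) := by
      linear_combination h0
    have huD : X ^ s * -(h : PowerSeries k) - (g : PowerSeries k) ∈ conductorModule k H s :=
      mem_conductorModule (sub_mem (X_pow_mul_mem_of_mem_conductorModule hhD) g.2) (hf ▸ f.2)
    refine ⟨(⟨_, huD⟩, ⟨_, hhD⟩), ?_⟩
    exact Prod.ext (Subtype.ext hf.symm) (Prod.ext (Subtype.ext (sub_sub_cancel _ _))
      (Subtype.ext (neg_neg _)))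
  · rintro ⟨⟨u, v⟩, huv⟩
    obtain ⟨rfl, huv'⟩ := Prod.mk.inj huv
    obtain ⟨rfl, rfl⟩ := Prod.mk.inj huv'
    apply Subtype.ext
    change X ^ d * (X ^ s * (u : PowerSeries k) + X ^ s * (X ^ s * (v : PowerSeries k)
      - (u : PowerSeries k)) + X ^ (2 * s) * -(v : PowerSeries k)) = 0
    ring

theorem conductorPresentation_surjective (hH : IsSemidualizingShift H s d) :
    Function.Surjective (hH.conductorPresentation k) := by
  rintro ⟨x, hx⟩
  obtain ⟨f, hf, g, hg, h, hh, rfl⟩ := hH.mem_conductorModule_iff.1 hx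
  exact ⟨(⟨f, hf⟩, ⟨g, hg⟩, ⟨h, hh⟩), rfl⟩

end IsSemidualizingShift

/-! ### C is semidualizing and not free -/

namespace IsSemidualizingShift

variable {k : Type u} [Field k] {H : AddSubmonoid ℕ} {s d : ℕ}

theorem mem_twoTermModule_of_mem {f : PowerSeries k} (hf : f ∈ semigroupRing k H) :
    f ∈ twoTermModule k H s :=
  Supported.mono (T₁ := H) hf fun _ => mem_twoTermSet

theorem X_pow_mul_mem_twoTermModule {f : PowerSeries k} (hf : f ∈ semigroupRing k H) :
    X ^ s * f ∈ twoTermModule k H s := by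
  simpa using add_X_pow_mul_mem_twoTermModule (s := s) (zero_mem (semigroupRing k H)) hf

theorem exists_lift_twoTerm (hH : IsSemidualizingShift H s d)
    (φ : conductorModule k H s →ₗ[semigroupRing k H] twoTermModule k H s) :
    ∃ ψ : semigroupRing k H × semigroupRing k H →ₗ[semigroupRing k H] twoTermModule k H s,
      ψ ∘ₗ twoTermSyzygy k H s = φ := by
  obtain ⟨e, he, hφ⟩ := hH.exists_supported_of_linearMap φ
  obtain ⟨g, hg, h, hh, rfl⟩ := Supported.exists_of_threeTermSet he
  refine ⟨(LinearMap.toSpanSingleton _ _ ⟨h, hh⟩).coprod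
    (LinearMap.toSpanSingleton _ _ ⟨-g, neg_mem (mem_twoTermModule_of_mem hg)⟩), ?_⟩
  ext1 x
  apply Subtype.ext
  rw [hφ]
  change X ^ s * (x : PowerSeries k) * h + -(x : PowerSeries k) * -g = _
  ring

theorem exists_lift_conductor (hH : IsSemidualizingShift H s d)
    (φ : conductorModule k H s × conductorModule k H s →ₗ[semigroupRing k H]
      twoTermModule k H s) :
    ∃ ψ : semigroupRing k H × semigroupRing k H × semigroupRing k H →ₗ[semigroupRing k H]
      twoTermModule k H s, ψ ∘ₗ conductorSyzygy k H s = φ := by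
  obtain ⟨e₁, he₁, hφ₁⟩ := hH.exists_supported_of_linearMap (φ ∘ₗ LinearMap.inl _ _ _)
  obtain ⟨e₂, he₂, hφ₂⟩ := hH.exists_supported_of_linearMap (φ ∘ₗ LinearMap.inr _ _ _)
  obtain ⟨a₁, ha₁, b₁, hb₁, rfl⟩ := Supported.exists_of_threeTermSet he₁
  obtain ⟨a₂, ha₂, b₂, hb₂, rfl⟩ := Supported.exists_of_threeTermSet' he₂
  -- The images y₀, y₁, y₂ of the basis must satisfy t^s y₀ - y₁ = e₁ and t^s y₁ - y₂ = e₂.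
  -- Splitting e₁ = a₁ + t^s b₁ and e₂ = a₂ + t^(2s) b₂, the choice y₁ = t^s b₂ - a₁ makes y₀ and y₂
  -- lie in C.
  refine ⟨(LinearMap.toSpanSingleton _ _
      ⟨b₁ + b₂, add_mem hb₁ (mem_twoTermModule_of_mem hb₂)⟩).coprod
    ((LinearMap.toSpanSingleton _ _ ⟨X ^ s * b₂ - a₁,
      sub_mem (X_pow_mul_mem_twoTermModule hb₂) (mem_twoTermModule_of_mem ha₁)⟩).coprod
    (LinearMap.toSpanSingleton _ _ ⟨-(X ^ s * a₁ + a₂),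
      neg_mem (add_mem (X_pow_mul_mem_twoTermModule ha₁) ha₂)⟩)), ?_⟩
  ext1
  · ext1 x
    apply Subtype.ext
    rw [hφ₁]
    change X ^ s * (x : PowerSeries k) * (b₁ + b₂) + ((X ^ s * 0 - (x : PowerSeries k)) *
      (X ^ s * b₂ - a₁) + -0 * -(X ^ s * a₁ + a₂)) = _
    ring
  · ext1 x
    apply Subtype.ext
    rw [hφ₂]
    change X ^ s * 0 * (b₁ + b₂) + ((X ^ s * (x : PowerSeries k) - 0) *
      (X ^ s * b₂ - a₁) + -(x : PowerSeries k) * -(X ^ s * a₁ + a₂)) = _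
    ring

theorem mem_of_mem_twoTermSet (hH : IsSemidualizingShift H s d) {n : ℕ}
    (hn : n ∈ twoTermSet H s) (hn' : n + s ∈ twoTermSet H s) : n ∈ H := by
  obtain hn | ⟨h, hh, rfl⟩ := hn
  · exact hn
  obtain hn' | ⟨h', hh', e⟩ := hn'
  · exact hH.add_mem_of_mem h hh (by rwa [two_mul, ← add_assoc])
  · rwa [Nat.add_right_cancel e]

/-- An endomorphism is multiplication by the image g of 1; both g and t^s g lie in C, and by
`mem_of_mem_twoTermSet` this forces g ∈ R. -/
theorem homothety_bijective (hH : IsSemidualizingShift H s d) :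
    Function.Bijective (LinearMap.lsmul (semigroupRing k H) (twoTermModule k H s)) := by
  have h1 : (1 : PowerSeries k) ∈ twoTermModule k H s := mem_twoTermModule_of_mem (one_mem _)
  constructor
  · intro r r' h
    have : (r : PowerSeries k) * 1 = r' * 1 :=
      congrArg Subtype.val (LinearMap.congr_fun h ⟨1, h1⟩)
    exact Subtype.ext (by simpa using this)
  · intro φ
    obtain ⟨c, hc⟩ := hH.exists_forall_ge_mem
    obtain ⟨g, hg⟩ : ∃ g : twoTermModule k H s, g = φ ⟨1, h1⟩ := ⟨_, rfl⟩
    have key (x : twoTermModule k H s) : (φ x : PowerSeries k) = g * (x : PowerSeries k) := by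
      have := linearMap_cross_mul hc φ x ⟨1, h1⟩
      rw [← hg] at this
      simpa using this
    have hgs : X ^ s * (g : PowerSeries k) ∈ twoTermModule k H s := by
      have hs : (X ^ s : PowerSeries k) ∈ twoTermModule k H s := by
        simpa using X_pow_mul_mem_twoTermModule (s := s) (one_mem (semigroupRing k H))
      rw [mul_comm]
      exact key ⟨_, hs⟩ ▸ (φ _).2
    have hgR : (g : PowerSeries k) ∈ semigroupRing k H := fun n hn =>
      hH.mem_of_mem_twoTermSet (g.2 n hn) ((supported_X_pow_mul_iff (T := twoTermSet H s) s).1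
        hgs n hn)
    refine ⟨⟨g, hgR⟩, ?_⟩
    ext1 x
    exact Subtype.ext (key x).symm

theorem isSemidualizing (hH : IsSemidualizingShift H s d) :
    IsSemidualizing (semigroupRing k H) (twoTermModule k H s) where
  finite := Module.Finite.of_surjective _ twoTermPresentation_surjective
  homothety_bijective := hH.homothety_bijective
  ext_eq_zero := ext_subsingleton_of_forall_lift (R := semigroupRing k H)
    (M := conductorModule k H s) (N := semigroupRing k H × semigroupRing k H)
    (P := twoTermModule k H s) (Y := twoTermModule k H s)
    (f := twoTermSyzygy k H s) (g := twoTermPresentation k H s)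
    twoTermSyzygy_injective twoTerm_exact twoTermPresentation_surjective hH.exists_lift_twoTerm
    (ext_succ_subsingleton_of_syzygy_prod_self (R := semigroupRing k H)
      (N := semigroupRing k H × semigroupRing k H × semigroupRing k H)
      (P := conductorModule k H s) (Y := twoTermModule k H s)
      (f := conductorSyzygy k H s) (g := hH.conductorPresentation k)
      conductorSyzygy_injective hH.conductor_exact
      hH.conductorPresentation_surjective hH.exists_lift_conductor)

/-- If C = gR, then 1 ∈ gR makes g a unit of R, so t^s ∈ C = R, against s ∉ H. -/
theorem not_nonempty_equiv_ring (hH : IsSemidualizingShift H s d) :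
    ¬ Nonempty (twoTermModule k H s ≃ₗ[semigroupRing k H] semigroupRing k H) := by
  rintro ⟨e⟩
  obtain ⟨g, hg⟩ : ∃ g : twoTermModule k H s, g = e.symm 1 := ⟨_, rfl⟩
  have key (x : twoTermModule k H s) : (e x : PowerSeries k) * g = x := by
    have : e x • g = x := by rw [hg, ← map_smul, smul_eq_mul, mul_one, e.symm_apply_apply]
    exact congrArg Subtype.val this
  have h1 := key ⟨1, mem_twoTermModule_of_mem (one_mem _)⟩
  have h2 := key ⟨X ^ s * 1, X_pow_mul_mem_twoTermModule (one_mem _)⟩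
  obtain ⟨r, hr⟩ : ∃ r : semigroupRing k H,
    r = e ⟨1, mem_twoTermModule_of_mem (one_mem _)⟩ := ⟨_, rfl⟩
  obtain ⟨r', hr'⟩ : ∃ r' : semigroupRing k H,
    r' = e ⟨X ^ s * 1, X_pow_mul_mem_twoTermModule (one_mem _)⟩ := ⟨_, rfl⟩
  rw [← hr] at h1
  rw [← hr'] at h2
  have hr0 : constantCoeff (r : PowerSeries k) ≠ 0 := by
    intro h0
    have := congrArg constantCoeff h1
    rw [map_mul, h0, zero_mul] at this
    simp at this
  obtain ⟨u, hu⟩ := semigroupRing_isUnit k H r hr0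
  have hur : (r : PowerSeries k) * ((u⁻¹ : (semigroupRing k H)ˣ) : semigroupRing k H) = 1 := by
    rw [← hu]
    exact congrArg Subtype.val u.mul_inv
  have hgu : (g : PowerSeries k) = ((u⁻¹ : (semigroupRing k H)ˣ) : semigroupRing k H) := by
    linear_combination (((u⁻¹ : (semigroupRing k H)ˣ) : semigroupRing k H) : PowerSeries k) * h1
      - (g : PowerSeries k) * hur
  rw [hgu] at h2
  dsimp only at h2
  have hs : (X ^ s : PowerSeries k) ∈ semigroupRing k H := by
    rw [← mul_one (X ^ s)]
    refine Eq.subst (motive := (· ∈ semigroupRing k H)) h2 ?_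
    exact mul_mem r'.2 (SetLike.coe_mem _)
  exact hH.shift_notMem (hs s (by rw [coeff_X_pow_self]; exact one_ne_zero))

end IsSemidualizingShift

/-! ### The maximal ideal and the dimension of k⟦H⟧ -/

section LocalStructure

variable {k : Type u} [Field k] {H : AddSubmonoid ℕ}

theorem mem_maximalIdeal_semigroupRing_iff {f : semigroupRing k H} :
    f ∈ IsLocalRing.maximalIdeal (semigroupRing k H) ↔
      constantCoeff (f : PowerSeries k) = 0 := by
  rw [IsLocalRing.mem_maximalIdeal, mem_nonunits_iff]
  refine ⟨fun h => by_contra fun h' => h (semigroupRing_isUnit k H f h'), fun h hu => ?_⟩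
  have : IsUnit (constantCoeff (f : PowerSeries k)) :=
    (hu.map (semigroupRing k H).val).map constantCoeff
  exact this.ne_zero h

theorem ringKrullDim_semigroupRing {c : ℕ} (hc : ∀ n, c ≤ n → n ∈ H) :
    ringKrullDim (semigroupRing k H) = 1 := by
  have hmem (f : PowerSeries k) : X ^ c * f ∈ semigroupRing k H :=
    (supported_X_pow_mul_iff (T := H) c).2 fun n _ => hc _ (Nat.le_add_left c n)
  rw [ringKrullDim_eq_one_iff_of_isLocalRing_isDomain]
  constructor
  · intro hF
    have hx : (⟨X ^ (c + 1), X_pow_mem_semigroupRing (hc _ (Nat.le_succ c))⟩ :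
        semigroupRing k H) ≠ 0 := fun h =>
      pow_ne_zero (c + 1) (X_ne_zero (R := k)) (congrArg Subtype.val h)
    obtain ⟨y, hy⟩ := hF.mul_inv_cancel hx
    have := congrArg (fun z : semigroupRing k H => constantCoeff (z : PowerSeries k)) hy
    simp at this
  · intro x hx g hg
    have hx0 : (x : PowerSeries k) ≠ 0 := fun h => hx (Subtype.ext h)
    have hw : constantCoeff (divXPowOrder (x : PowerSeries k)) ≠ 0 := fun h =>
      hx0 (constantCoeff_divXPowOrder_eq_zero_iff.1 h)
    obtain ⟨v, hv⟩ := pow_dvd_pow_of_dvd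
      (X_dvd_iff.2 (mem_maximalIdeal_semigroupRing_iff.1 hg)) ((x : PowerSeries k).order.toNat + c)
    -- With x = t^o w and w a unit, g^(o+c) = t^(o+c) v is x times t^c w⁻¹ v, which lies in R
    -- because its order is at least c.
    refine ⟨(x : PowerSeries k).order.toNat + c, Ideal.mem_span_singleton'.2
      ⟨⟨_, hmem ((divXPowOrder (x : PowerSeries k))⁻¹ * v)⟩, Subtype.ext ?_⟩⟩
    change X ^ c * ((divXPowOrder (x : PowerSeries k))⁻¹ * v) * (x : PowerSeries k) =
      (g : PowerSeries k) ^ ((x : PowerSeries k).order.toNat + c)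
    rw [hv]
    have h1 := PowerSeries.mul_inv_cancel _ hw
    have h2 := X_pow_order_mul_divXPowOrder (f := (x : PowerSeries k))
    generalize divXPowOrder (x : PowerSeries k) = w at h1 h2
    rw [pow_add]
    linear_combination X ^ c * v * X ^ (x : PowerSeries k).order.toNat * h1
      - X ^ c * w⁻¹ * v * h2

end LocalStructure

/-! ### Two socle monomials prevent C from being canonical -/

namespace IsSemidualizingShift

variable {k : Type u} [Field k] {H : AddSubmonoid ℕ} {s d : ℕ}

variable (k H s) in
/-- Multiplication by `t ^ n` on the maximal ideal, for a socle exponent `n` of `R + t ^ s R`. -/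
noncomputable def socleMap (n : ℕ) (hn : ∀ h ∈ H, h ≠ 0 → n + h ∈ twoTermSet H s) :
    IsLocalRing.maximalIdeal (semigroupRing k H) →ₗ[semigroupRing k H] twoTermModule k H s where
  toFun x := ⟨X ^ n * ((x : semigroupRing k H) : PowerSeries k), by
    refine (supported_X_pow_mul_iff (T := twoTermSet H s) n).2 fun m hm => ?_
    rw [Set.mem_ofPred_eq, add_comm]
    refine hn m ((x : semigroupRing k H).2 m hm) fun h0 => hm ?_
    rw [h0, coeff_zero_eq_constantCoeff_apply]
    exact mem_maximalIdeal_semigroupRing_iff.1 x.2⟩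
  map_add' _ _ := Subtype.ext (mul_add _ _ _)
  map_smul' _ _ := Subtype.ext (mul_left_comm _ _ _)

theorem not_nonempty_equiv_canonical (hH : IsSemidualizingShift H s d) {n₁ n₂ : ℕ}
    (hlt : n₁ < n₂) (h₁ : n₁ ∉ twoTermSet H s) (h₂ : n₂ ∉ twoTermSet H s)
    (hs₁ : ∀ h ∈ H, h ≠ 0 → n₁ + h ∈ twoTermSet H s)
    (hs₂ : ∀ h ∈ H, h ≠ 0 → n₂ + h ∈ twoTermSet H s)
    {K : Type u} [AddCommGroup K] [Module (semigroupRing k H) K]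
    (hK : IsCanonicalModule (semigroupRing k H) K) :
    ¬ Nonempty (twoTermModule k H s ≃ₗ[semigroupRing k H] K) := by
  rintro ⟨i⟩
  obtain ⟨c, hc⟩ := hH.exists_forall_ge_mem
  obtain ⟨-, ⟨n, hn, -, ⟨e⟩⟩, -⟩ := hK
  rw [ringKrullDim_semigroupRing hc] at hn
  obtain rfl : n = 1 := by exact_mod_cast hn.symm
  obtain ⟨a, b, hab, z, hz⟩ := exists_extension_of_ext_one_residueField e
    (i.toLinearMap ∘ₗ socleMap k H s n₁ hs₁) (i.toLinearMap ∘ₗ socleMap k H s n₂ hs₂)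
  obtain ⟨y, rfl⟩ := i.surjective z
  have key (x : IsLocalRing.maximalIdeal (semigroupRing k H)) :
      (x : semigroupRing k H) • y =
        a • socleMap k H s n₁ hs₁ x + b • socleMap k H s n₂ hs₂ x := by
    apply i.injective
    rw [map_smul, map_add, map_smul, map_smul]
    exact hz x
  have hXm : (⟨X ^ (c + 1), X_pow_mem_semigroupRing (hc _ (Nat.le_succ c))⟩ :
      semigroupRing k H) ∈ IsLocalRing.maximalIdeal (semigroupRing k H) :=
    mem_maximalIdeal_semigroupRing_iff.2 (by simp)
  have hy' : (y : PowerSeries k) = (a : PowerSeries k) * X ^ n₁ + (b : PowerSeries k) * X ^ n₂ := by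
    have h : X ^ (c + 1) * (y : PowerSeries k) =
        (a : PowerSeries k) * (X ^ n₁ * X ^ (c + 1)) +
          (b : PowerSeries k) * (X ^ n₂ * X ^ (c + 1)) :=
      congrArg Subtype.val (key ⟨_, hXm⟩)
    refine mul_left_cancel₀ (pow_ne_zero (c + 1) (X_ne_zero (R := k))) ?_
    linear_combination h
  -- Since n₁ < n₂, the coefficient of t^n₁ in y is the constant term of a; it vanishes because n₁
  -- is not an exponent of C.
  have ha : a ∈ IsLocalRing.maximalIdeal (semigroupRing k H) := by
    rw [mem_maximalIdeal_semigroupRing_iff]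
    have := y.2.coeff_eq_zero h₁
    rw [hy', map_add, coeff_mul_X_pow', coeff_mul_X_pow', if_pos le_rfl, if_neg hlt.not_ge,
      Nat.sub_self, add_zero] at this
    simpa using this
  have hb : b ∈ IsLocalRing.maximalIdeal (semigroupRing k H) := by
    rw [mem_maximalIdeal_semigroupRing_iff]
    -- As a ∈ 𝔪, the term a t^n₁ lies in C and can be subtracted, leaving b t^n₂ ∈ C.
    have := (sub_mem y.2 (socleMap k H s n₁ hs₁ ⟨a, ha⟩).2).coeff_eq_zero h₂
    have h : (y : PowerSeries k) - (socleMap k H s n₁ hs₁ ⟨a, ha⟩ : PowerSeries k) =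
        (b : PowerSeries k) * X ^ n₂ := by
      rw [hy']
      change _ - X ^ n₁ * (a : PowerSeries k) = _
      ring
    rw [h, coeff_mul_X_pow', if_pos le_rfl, Nat.sub_self] at this
    simpa using this
  exact hab.elim (· ha) (· hb)

theorem hasNontrivialSemidualizingModule (hH : IsSemidualizingShift H s d) {n₁ n₂ : ℕ}
    (hlt : n₁ < n₂) (h₁ : n₁ ∉ twoTermSet H s) (h₂ : n₂ ∉ twoTermSet H s)
    (hs₁ : ∀ h ∈ H, h ≠ 0 → n₁ + h ∈ twoTermSet H s)
    (hs₂ : ∀ h ∈ H, h ≠ 0 → n₂ + h ∈ twoTermSet H s) :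
    HasNontrivialSemidualizingModule (semigroupRing k H) :=
  ⟨twoTermModule k H s, inferInstance, inferInstance, hH.isSemidualizing,
    hH.not_nonempty_equiv_ring,
    fun _ _ _ hK => hH.not_nonempty_equiv_canonical hlt h₁ h₂ hs₁ hs₂ hK⟩

end IsSemidualizingShift

/-! ### Lengths and multiplicity along a filtration -/

/-- The hypotheses say that J/I is generated by x with annihilator 𝔪, hence is a copy of the residue
field. -/
theorem Ideal.length_quotient_eq_one_add {R : Type u} [CommRing R] [IsLocalRing R]
    {I J : Ideal R} (hIJ : I ≤ J) {x : R} (hx : x ∈ J)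
    (hxI : ∀ r, r * x ∈ I ↔ r ∈ IsLocalRing.maximalIdeal R)
    (hJ : ∀ y ∈ J, ∃ r, y - r * x ∈ I) :
    Module.length R (R ⧸ I) = 1 + Module.length R (R ⧸ J) := by
  have : IsSimpleModule R (R ⧸ IsLocalRing.maximalIdeal R) :=
    isSimpleModule_iff_isCoatom.2 (IsLocalRing.maximalIdeal.isMaximal R).out
  rw [← Module.length_eq_one R (R ⧸ IsLocalRing.maximalIdeal R)]
  have hle : IsLocalRing.maximalIdeal R ≤ Submodule.comap (LinearMap.toSpanSingleton R R x) I :=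
    fun r hr => (hxI r).2 hr
  have hmk (r : R) : Submodule.mapQ _ I (LinearMap.toSpanSingleton R R x) hle
      (Submodule.Quotient.mk r) = Submodule.Quotient.mk (r * x) := rfl
  refine Module.length_eq_add_of_exact
    (Submodule.mapQ (IsLocalRing.maximalIdeal R) I (LinearMap.toSpanSingleton R R x) hle)
    (Submodule.factor hIJ) ?_ (Submodule.factor_surjective hIJ) ?_
  · rw [injective_iff_map_eq_zero]
    intro y
    obtain ⟨r, rfl⟩ := Submodule.Quotient.mk_surjective _ y
    intro h
    rw [hmk, Submodule.Quotient.mk_eq_zero] at h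
    exact (Submodule.Quotient.mk_eq_zero _).2 ((hxI r).1 h)
  · intro y
    obtain ⟨y, rfl⟩ := Submodule.Quotient.mk_surjective _ y
    rw [show Submodule.factor hIJ (Submodule.Quotient.mk y) = Submodule.Quotient.mk y from rfl,
      Submodule.Quotient.mk_eq_zero]
    constructor
    · intro hy
      obtain ⟨r, hr⟩ := hJ y hy
      refine ⟨Submodule.Quotient.mk r, ?_⟩
      rw [hmk, eq_comm, Submodule.Quotient.eq]
      exact hr
    · rintro ⟨r, hr⟩
      obtain ⟨r, rfl⟩ := Submodule.Quotient.mk_surjective _ r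
      rw [hmk, Submodule.Quotient.eq] at hr
      have h := sub_mem (J.mul_mem_left r hx) (hIJ hr)
      rwa [sub_sub_cancel] at h

/-- The multiplicity of a one-dimensional local ring with an ideal filtration whose successive
quotients have length at most one. -/
theorem hasMultiplicity_of_filtration {R : Type u} [CommRing R] [IsLocalRing R]
    (hdim : ringKrullDim R = 1) {I : ℕ → Ideal R} {p : ℕ → Prop} (hI : I 0 = ⊤)
    (hle : ∀ n, I (n + 1) ≤ I n)
    (hp : ∀ n, p n → ∃ x ∈ I n, (∀ r, r * x ∈ I (n + 1) ↔ r ∈ IsLocalRing.maximalIdeal R) ∧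
      ∀ y ∈ I n, ∃ r, y - r * x ∈ I (n + 1))
    (hnp : ∀ n, ¬ p n → I n ≤ I (n + 1)) {a c : ℕ} (hc : ∀ n, c ≤ n → p n)
    (hpow : ∀ n, IsLocalRing.maximalIdeal R ^ n ≤ I (a * n))
    (hpow' : ∀ n, I (a * n + c) ≤ IsLocalRing.maximalIdeal R ^ n) : HasMultiplicity R a := by
  classical
  have hlen (n : ℕ) : Module.length R (R ⧸ I n) = Nat.count p n := by
    induction n with
    | zero =>
      rw [hI, Nat.count_zero, Nat.cast_zero]
      exact Module.length_eq_zero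
    | succ n ih =>
      rw [Nat.count_succ]
      split_ifs with hn
      · obtain ⟨x, hx, hx', hy⟩ := hp n hn
        rw [Nat.cast_add, ← ih, Nat.cast_one, add_comm (Module.length R _)]
        exact Ideal.length_quotient_eq_one_add (hle n) hx hx' hy
      · rw [add_zero, ← ih, le_antisymm (hle n) (hnp n hn)]
  -- At most c indices fail p, so the length of R/Iₙ is n up to an error bounded by c.
  have hcount (n : ℕ) : n ≤ Nat.count p n + c := by
    induction n with
    | zero => exact Nat.zero_le _
    | succ n ih =>
      rw [Nat.count_succ]
      split_ifs with h
      · omega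
      · have := mt (hc n) h
        omega
  refine ⟨1, hdim, ?_⟩
  have hbound (n : ℕ) :
      a * n ≤ (Module.length R (R ⧸ IsLocalRing.maximalIdeal R ^ n)).toNat + c ∧
        (Module.length R (R ⧸ IsLocalRing.maximalIdeal R ^ n)).toNat ≤ a * n + c := by
    have h1 := Module.length_le_of_surjective
      (Submodule.factor (hpow n)) (Submodule.factor_surjective _)
    have h2 := Module.length_le_of_surjective
      (Submodule.factor (hpow' n)) (Submodule.factor_surjective _)
    rw [hlen] at h1 h2
    obtain ⟨l, hl⟩ := ENat.ne_top_iff_exists.1 (ne_top_of_le_ne_top (ENat.natCast_ne_top _) h2)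
    rw [← hl] at h1 h2 ⊢
    rw [ENat.toNat_natCast]
    have h1 := Nat.cast_le.1 h1
    have h2 := Nat.cast_le.1 h2
    have h3 := hcount (a * n)
    have h4 := Nat.count_le (p := p) (n := a * n + c)
    omega
  have hlim : Filter.Tendsto (fun n : ℕ => (c : ℝ) / n) Filter.atTop (nhds 0) :=
    tendsto_const_div_atTop_nhds_zero_nat (c : ℝ)
  refine tendsto_of_tendsto_of_tendsto_of_le_of_le' (g := fun n : ℕ => (a : ℝ) - c / n)
    (h := fun n : ℕ => (a : ℝ) + c / n) (by simpa using hlim.const_sub (a : ℝ))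
    (by simpa using hlim.const_add (a : ℝ)) ?_ ?_
  all_goals
    filter_upwards [Filter.eventually_gt_atTop 0] with n hn
    have hn' : (0 : ℝ) < n := by exact_mod_cast hn
    rw [Nat.factorial_one, Nat.cast_one, one_mul, pow_one]
  · rw [le_div_iff₀ hn', sub_mul, div_mul_cancel₀ _ hn'.ne', sub_le_iff_le_add]
    exact_mod_cast (hbound n).1
  · rw [div_le_iff₀ hn', add_mul, div_mul_cancel₀ _ hn'.ne']
    exact_mod_cast (hbound n).2

/-! ### The order filtration of k⟦H⟧ -/

section Multiplicity

variable (k : Type u) [Field k] (H : AddSubmonoid ℕ)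

/-- The ideal of `k⟦H⟧` of all power series of order at least `n`. -/
def orderIdeal (n : ℕ) : Ideal (semigroupRing k H) where
  carrier := {f | Supported {m | n ≤ m} (f : PowerSeries k)}
  add_mem' hf hg := Supported.add hf hg
  zero_mem' _ hn := absurd (map_zero _) hn
  smul_mem' r _ hf := Supported.mul (T₁ := H) r.2 hf fun _ _ _ h => Nat.le_add_left_of_le h

variable {k H}

theorem mem_orderIdeal_iff {n : ℕ} {f : semigroupRing k H} :
    f ∈ orderIdeal k H n ↔ ∀ m, coeff m (f : PowerSeries k) ≠ 0 → n ≤ m := Iff.rfl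

theorem orderIdeal_zero : orderIdeal k H 0 = ⊤ :=
  (Ideal.eq_top_iff_one _).2 (mem_orderIdeal_iff.2 fun _ _ => Nat.zero_le _)

theorem orderIdeal_succ_le (n : ℕ) : orderIdeal k H (n + 1) ≤ orderIdeal k H n :=
  fun _ hf m hm => (Nat.le_succ n).trans (mem_orderIdeal_iff.1 hf m hm)

theorem orderIdeal_le_succ {n : ℕ} (hn : n ∉ H) : orderIdeal k H n ≤ orderIdeal k H (n + 1) :=
  fun f hf m hm => lt_of_le_of_ne (mem_orderIdeal_iff.1 hf m hm) fun e => hn (e ▸ f.2 m hm)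

theorem exists_orderIdeal_eq_span_sup {n : ℕ} (hn : n ∈ H) : ∃ x ∈ orderIdeal k H n,
    (∀ r, r * x ∈ orderIdeal k H (n + 1) ↔ r ∈ IsLocalRing.maximalIdeal (semigroupRing k H)) ∧
      ∀ y ∈ orderIdeal k H n, ∃ r, y - r * x ∈ orderIdeal k H (n + 1) := by
  refine ⟨⟨X ^ n, X_pow_mem_semigroupRing hn⟩, supported_X_pow (T := {m | n ≤ m}) (le_refl n),
    fun r => ?_, fun y hy => ?_⟩
  · rw [mem_maximalIdeal_semigroupRing_iff]
    constructor
    · intro h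
      have := Supported.coeff_eq_zero h (n := n) (by simp)
      rwa [MulMemClass.coe_mul, coeff_mul_X_pow', if_pos le_rfl, Nat.sub_self,
        coeff_zero_eq_constantCoeff_apply] at this
    · intro h m hm
      rw [MulMemClass.coe_mul, coeff_mul_X_pow'] at hm
      split_ifs at hm with hnm
      · refine lt_of_le_of_ne hnm fun e => hm ?_
        rw [e, Nat.sub_self, coeff_zero_eq_constantCoeff_apply, h]
      · exact absurd rfl hm
  · refine ⟨algebraMap k _ (coeff n (y : PowerSeries k)), fun m hm => ?_⟩
    have hco : coeff m (y : PowerSeries k) -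
        coeff n (y : PowerSeries k) * coeff m (X ^ n : PowerSeries k) ≠ 0 := by
      rw [← coeff_C_mul, ← map_sub]
      exact hm
    rw [coeff_X_pow] at hco
    split_ifs at hco with h
    · subst h
      exact absurd (by ring) hco
    · rw [mul_zero, sub_zero] at hco
      exact lt_of_le_of_ne (mem_orderIdeal_iff.1 hy m hco) (Ne.symm h)

theorem maximalIdeal_pow_le {a : ℕ} (ha : ∀ h ∈ H, h ≠ 0 → a ≤ h) (n : ℕ) :
    IsLocalRing.maximalIdeal (semigroupRing k H) ^ n ≤ orderIdeal k H (a * n) := by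
  induction n with
  | zero => exact fun f _ => mem_orderIdeal_iff.2 fun _ _ => Nat.zero_le _
  | succ n ih =>
    rw [pow_succ, Ideal.mul_le]
    intro f hf g hg
    have hf' := mem_orderIdeal_iff.1 (ih hf)
    refine Supported.mul (T₁ := {m | a * n ≤ m}) (T₂ := {m | a ≤ m}) hf' (fun m hm => ?_)
      fun i hi j hj => ?_
    · refine ha m (g.2 m hm) fun h => hm ?_
      rw [h, coeff_zero_eq_constantCoeff_apply]
      exact mem_maximalIdeal_semigroupRing_iff.1 hg
    · exact Nat.add_le_add (show a * n ≤ i from hi) hj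

theorem orderIdeal_le_pow {a c : ℕ} (ha : a ∈ H) (ha0 : a ≠ 0) (hc : ∀ n, c ≤ n → n ∈ H) (n : ℕ) :
    orderIdeal k H (a * n + c) ≤ IsLocalRing.maximalIdeal (semigroupRing k H) ^ n := by
  intro f hf
  have hdvd : (X ^ (a * n + c) : PowerSeries k) ∣ f :=
    X_pow_dvd_iff.2 fun m hm => by_contra fun h => absurd (mem_orderIdeal_iff.1 hf m h) hm.not_ge
  obtain ⟨g, hg⟩ := hdvd
  have hXm : (⟨X ^ a, X_pow_mem_semigroupRing ha⟩ : semigroupRing k H) ∈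
      IsLocalRing.maximalIdeal (semigroupRing k H) :=
    mem_maximalIdeal_semigroupRing_iff.2 (by simp [ha0])
  have hmem : X ^ c * g ∈ semigroupRing k H :=
    (supported_X_pow_mul_iff (T := H) c).2 fun n _ => hc _ (Nat.le_add_left c n)
  have : f = ⟨_, hmem⟩ * (⟨X ^ a, X_pow_mem_semigroupRing ha⟩ : semigroupRing k H) ^ n := by
    apply Subtype.ext
    rw [hg]
    change _ = X ^ c * g * (X ^ a) ^ n
    ring
  rw [this]
  exact Ideal.mul_mem_left _ _ (Ideal.pow_mem_pow hXm n)

theorem hasMultiplicity_semigroupRing {a c : ℕ} (ha : a ∈ H) (ha0 : a ≠ 0)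
    (hle : ∀ h ∈ H, h ≠ 0 → a ≤ h) (hc : ∀ n, c ≤ n → n ∈ H) :
    HasMultiplicity (semigroupRing k H) a :=
  hasMultiplicity_of_filtration (R := semigroupRing k H) (I := orderIdeal k H) (p := (· ∈ H))
    (ringKrullDim_semigroupRing hc) orderIdeal_zero orderIdeal_succ_le
    (fun _ => exists_orderIdeal_eq_span_sup) (fun _ => orderIdeal_le_succ) hc
    (maximalIdeal_pow_le hle) (orderIdeal_le_pow ha ha0 hc)

end Multiplicity

/-- The function `m` gives the quotients by `p` of the least elements in each residue class of a
numerical semigroup whose ring is free over `k⟦t ^ (3 * p), t ^ (4 * p), t ^ (5 * p)⟧`. -/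
structure IsKunzFunction (p : ℕ) (m : ℕ → ℕ) : Prop where
  pos : 0 < p
  zero : m 0 = 0
  add_of_lt : ∀ i j, i + j < p → m i + m j = m (i + j) ∨ m (i + j) + 3 ≤ m i + m j
  add_of_le : ∀ i j, i < p → j < p → p ≤ i + j →
    m i + m j + 1 = m (i + j - p) ∨ m (i + j - p) + 3 ≤ m i + m j + 1

/-! ### Semigroups free over ⟨3p, 4p, 5p⟩ -/

namespace IsKunzFunction

variable {p : ℕ} {m : ℕ → ℕ}

/-- Here ε is the carry when the residues of x and y are added. The defect of m, carry included, is
in ⟨3, 4, 5⟩ = {0} ∪ [3, ∞). -/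
theorem add_cases (hm : IsKunzFunction p m) (x y : ℕ) :
    ∃ ε, (x + y) / p = x / p + y / p + ε ∧ (m (x % p) + m (y % p) + ε = m ((x + y) % p) ∨
      m ((x + y) % p) + 3 ≤ m (x % p) + m (y % p) + ε) := by
  have hx := Nat.mod_lt x hm.pos
  have hy := Nat.mod_lt y hm.pos
  rw [Nat.add_div hm.pos, Nat.add_mod]
  split_ifs with h
  · refine ⟨1, rfl, ?_⟩
    rw [Nat.mod_eq_sub_mod h, Nat.mod_eq_of_lt (a := x % p + y % p - p) (by omega)]
    exact hm.add_of_le _ _ hx hy h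
  · refine ⟨0, rfl, ?_⟩
    rw [Nat.mod_eq_of_lt (a := x % p + y % p) (by omega)]
    exact hm.add_of_lt _ _ (by omega)

/-- The numerical semigroup attached to a Kunz function. -/
def semigroup (hm : IsKunzFunction p m) : AddSubmonoid ℕ where
  carrier := {n | n / p = m (n % p) ∨ m (n % p) + 3 ≤ n / p}
  zero_mem' := Or.inl (by rw [Nat.zero_div, Nat.zero_mod, hm.zero])
  add_mem' {x y} hx hy := by
    obtain ⟨ε, hε, h⟩ := hm.add_cases x y
    rw [Set.mem_ofPred_eq] at hx hy ⊢
    omega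

variable (hm : IsKunzFunction p m)
include hm

theorem mem_semigroup {n : ℕ} :
    n ∈ hm.semigroup ↔ n / p = m (n % p) ∨ m (n % p) + 3 ≤ n / p := Iff.rfl

theorem add_mul_mem_semigroup {n i : ℕ} :
    n + i * p ∈ hm.semigroup ↔ n / p + i = m (n % p) ∨ m (n % p) + 3 ≤ n / p + i := by
  rw [mem_semigroup, Nat.add_mul_div_right _ _ hm.pos, Nat.add_mul_mod_self_right]

theorem mem_twoTermSet_iff {n : ℕ} : n ∈ twoTermSet hm.semigroup p ↔
    n / p = m (n % p) ∨ n / p = m (n % p) + 1 ∨ m (n % p) + 3 ≤ n / p := by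
  constructor
  · rintro (h | ⟨h, hh, rfl⟩)
    · rw [mem_semigroup] at h
      omega
    · rw [mem_semigroup] at hh
      rw [Nat.add_div_right _ hm.pos, Nat.add_mod_right]
      omega
  · intro h
    by_cases h1 : n / p = m (n % p) + 1
    · have hn : p ≤ n := by
        by_contra hlt
        rw [Nat.div_eq_of_lt (by omega)] at h1
        omega
      obtain ⟨n, rfl⟩ := Nat.exists_eq_add_of_le' hn
      refine Or.inr ⟨n, ?_, rfl⟩
      rw [Nat.add_div_right _ hm.pos, Nat.add_mod_right] at h1
      rw [mem_semigroup]
      omega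
    · refine Or.inl ?_
      rw [mem_semigroup]
      omega

theorem mem_threeTermSet {n : ℕ} (h : m (n % p) ≤ n / p) :
    n ∈ threeTermSet hm.semigroup p := by
  by_cases h1 : n / p = m (n % p) + 1 ∨ n / p = m (n % p) + 2
  · have hn : p ≤ n := by
      by_contra hlt
      rw [Nat.div_eq_of_lt (by omega)] at h1
      omega
    obtain ⟨n, rfl⟩ := Nat.exists_eq_add_of_le' hn
    refine Or.inr ⟨n, ?_, rfl⟩
    rw [Nat.add_div_right _ hm.pos, Nat.add_mod_right] at h1
    rw [mem_twoTermSet_iff]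
    omega
  · refine Or.inl ?_
    rw [mem_semigroup]
    omega

theorem exists_mem_threeTermSet {n : ℕ} (h : m (n % p) + 3 ≤ n / p) :
    ∃ e ∈ threeTermSet hm.semigroup p, n = e + 3 * p := by
  have hn : 3 * p ≤ n := (Nat.le_div_iff_mul_le hm.pos).1 (by omega)
  obtain ⟨n, rfl⟩ := Nat.exists_eq_add_of_le' hn
  rw [Nat.add_mul_div_right _ _ hm.pos, Nat.add_mul_mod_self_right] at h
  exact ⟨n, hm.mem_threeTermSet (by omega), rfl⟩

theorem mul_mem_semigroup {i : ℕ} (hi : 3 ≤ i) : i * p ∈ hm.semigroup := by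
  rw [← zero_add (i * p), add_mul_mem_semigroup, Nat.zero_div, Nat.zero_mod, hm.zero]
  omega

theorem exists_forall_ge_mem : ∃ c, ∀ n, c ≤ n → n ∈ hm.semigroup := by
  refine ⟨(∑ i ∈ Finset.range p, m i + 3) * p, fun n hn => ?_⟩
  have h := (Nat.le_div_iff_mul_le hm.pos).2 hn
  have h' := Finset.single_le_sum (f := m) (fun _ _ => Nat.zero_le _)
    (Finset.mem_range.2 (Nat.mod_lt n hm.pos))
  rw [mem_semigroup]
  omega

theorem isNumericalSemigroup : IsNumericalSemigroup hm.semigroup := by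
  intro d hd
  obtain ⟨c, hc⟩ := hm.exists_forall_ge_mem
  exact Nat.dvd_one.1 ((Nat.dvd_add_right (hd c (hc c le_rfl))).1 (hd (c + 1) (hc _ (Nat.le_succ c))))

/-- Everything is read off from the offset i = n / p - m(n % p): H has offsets {0, 3, 4, …} and C
has {0, 1, 3, 4, …}. If i, i + 1 are offsets of H, or i, i + 1, i + 2 are offsets of C, then i ≥ 3.
-/
theorem isSemidualizingShift : IsSemidualizingShift hm.semigroup p (3 * p) where
  exists_forall_ge_mem := hm.exists_forall_ge_mem
  d_mem := hm.mul_mem_semigroup le_rfl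
  d_add_mem := by rw [← Nat.succ_mul]; exact hm.mul_mem_semigroup (by decide)
  d_add_two_mul_mem := by rw [← add_mul]; exact hm.mul_mem_semigroup (by decide)
  d_add_three_mul_mem := by rw [← add_mul]; exact hm.mul_mem_semigroup (by decide)
  shift_notMem := by
    rw [mem_semigroup, Nat.div_self hm.pos, Nat.mod_self, hm.zero]
    decide
  add_mem_of_mem n hn hn' := by
    rw [add_mul_mem_semigroup] at hn'
    rw [mem_semigroup] at hn ⊢
    rw [Nat.add_div_right _ hm.pos, Nat.add_mod_right]
    omega
  exists_of_mem_conductorSet n hn := by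
    obtain ⟨hn, hn'⟩ := hn
    rw [mem_semigroup] at hn hn'
    rw [Nat.add_div_right _ hm.pos, Nat.add_mod_right] at hn'
    exact hm.exists_mem_threeTermSet (by omega)
  exists_of_add_mem_twoTermSet n h₀ h₁ h₂ := by
    rw [mem_twoTermSet_iff] at h₀ h₁ h₂
    rw [Nat.add_div_right _ hm.pos, Nat.add_mod_right] at h₁
    rw [Nat.add_mul_div_right _ _ hm.pos, Nat.add_mul_mod_self_right] at h₂
    exact hm.exists_mem_threeTermSet (by omega)

theorem socle_notMem {r : ℕ} (hr : r < p) : r + (m r + 2) * p ∉ twoTermSet hm.semigroup p := by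
  rw [mem_twoTermSet_iff, Nat.add_mul_div_right _ _ hm.pos, Nat.add_mul_mod_self_right,
    Nat.mod_eq_of_lt hr, Nat.div_eq_of_lt hr]
  omega

/-- Offset 2 is the only nonnegative offset missing from C. The hypotheses exclude zero defects, so
adding an element of nonzero residue raises the offset by at least 3; a nonzero element of residue 0
is at least 3p. -/
theorem socle_add_mem {r : ℕ} (hr : r < p)
    (hlt : ∀ j, 0 < j → r + j < p → m r + m j ≠ m (r + j))
    (hle : ∀ j, j < p → p ≤ r + j → m r + m j + 1 ≠ m (r + j - p)) :
    ∀ h ∈ hm.semigroup, h ≠ 0 → r + (m r + 2) * p + h ∈ twoTermSet hm.semigroup p := by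
  intro h hh h0
  have hj := Nat.mod_lt h hm.pos
  rw [mem_semigroup] at hh
  rw [mem_twoTermSet_iff, add_right_comm, Nat.add_mul_div_right _ _ hm.pos,
    Nat.add_mul_mod_self_right, Nat.add_div hm.pos, Nat.add_mod, Nat.mod_eq_of_lt hr,
    Nat.div_eq_of_lt hr]
  have hdm := Nat.div_add_mod h p
  split_ifs with hp
  · have h1 := hle _ hj hp
    have h2 := hm.add_of_le _ _ hr hj hp
    rw [Nat.mod_eq_sub_mod hp, Nat.mod_eq_of_lt (by omega)]
    omega
  · rw [Nat.mod_eq_of_lt (by omega)]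
    rcases Nat.eq_zero_or_pos (h % p) with hz | hz
    · have : h / p ≠ 0 := by
        intro hq
        rw [hq, hz] at hdm
        omega
      simp only [hz, add_zero]
      rw [hz, hm.zero] at hh
      omega
    · have h1 := hlt _ hz (by omega)
      have h2 := hm.add_of_lt r (h % p) (by omega)
      omega

end IsKunzFunction

/-! ### The semigroups of multiplicity a -/

/-- Two of the last j residues always carry, and 2 + 2 + 1 equals 5 and exceeds 2 by exactly 3. A
sum 5 + 2 without carry lands among the last j residues, where the value is 2; the remaining sums of
nonzero residues are at least 5 + 3. -/
theorem isKunzFunction_ite {p j : ℕ} (hp : 3 ≤ p) (hj : j ≤ 2) (hpj : j = 0 ∨ 4 ≤ p) :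
    IsKunzFunction p fun r => if r = 0 then 0 else if r + j < p then 5 else 2 where
  pos := by omega
  zero := rfl
  add_of_lt i i' h := by
    split_ifs <;> omega
  add_of_le i i' h h' hle := by
    split_ifs <;> omega

/-- For multiplicity 10 the two-valued family has p = 4, j = 2, and only residue 1 takes the value
5. Here the least elements of the classes are 0, 29, 30, 10, 39, 19, 20, with socle residues 2 and
4. -/
theorem isKunzFunction_seven :
    IsKunzFunction 7 fun r => ([0, 4, 4, 1, 5, 2, 2] : List ℕ).getD r 0 where
  pos := by decide
  zero := rfl
  add_of_lt i j h := by
    have hi : i < 7 := by omega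
    have hj : j < 7 := by omega
    revert h
    interval_cases i <;> interval_cases j <;> decide
  add_of_le i j hi hj h := by
    revert h
    interval_cases i <;> interval_cases j <;> decide

theorem theorem5p5 (k : Type u) [Field k] (a : ℕ) (ha : 9 ≤ a) :
    ∃ H : AddSubmonoid ℕ, IsNumericalSemigroup H ∧
      HasMultiplicity (semigroupRing k H) a ∧
      HasNontrivialSemidualizingModule (semigroupRing k H) := by
  by_cases h10 : a = 10
  · subst h10
    have hm := isKunzFunction_seven
    obtain ⟨c, hc⟩ := hm.exists_forall_ge_mem
    refine ⟨hm.semigroup, hm.isNumericalSemigroup, hasMultiplicity_semigroupRing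
      (hm.mem_semigroup.2 (by decide)) (by decide) (fun h hh h0 => ?_) hc,
      hm.isSemidualizingShift.hasNontrivialSemidualizingModule (by decide)
        (hm.socle_notMem (r := 2) (by decide)) (hm.socle_notMem (r := 4) (by decide))
        (hm.socle_add_mem (by decide) (fun j h h' => ?_) fun j h h' => ?_)
        (hm.socle_add_mem (by decide) (fun j h h' => ?_) fun j h h' => ?_)⟩
    · by_contra hlt
      have hlt : h < 10 := by omega
      rw [hm.mem_semigroup] at hh
      revert hh h0
      interval_cases h <;> decide
    all_goals
      have hj : j < 7 := by omega
      revert h h'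
      interval_cases j <;> decide
  -- Here p is a / 3 rounded up. The bound 2 + j < p, which fails only for a = 10, gives residues 1
  -- and 2 the maximal value 5; no sum with a nonzero residue can equal a value of m, so both are
  -- socle residues.
  · obtain ⟨p, j, hp, hj, hpj, hpj', rfl⟩ : ∃ p j, 3 ≤ p ∧ j ≤ 2 ∧ (j = 0 ∨ 4 ≤ p) ∧
        2 + j < p ∧ a = 3 * p - j :=
      ⟨(a + 2) / 3, 3 * ((a + 2) / 3) - a, by omega, by omega, by omega, by omega, by omega⟩
    have hm := isKunzFunction_ite hp hj hpj
    obtain ⟨c, hc⟩ := hm.exists_forall_ge_mem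
    have h1 {r : ℕ} (h0 : r ≠ 0) (h : r + j < p) :
        (if r = 0 then 0 else if r + j < p then 5 else 2) = 5 := by rw [if_neg h0, if_pos h]
    refine ⟨hm.semigroup, hm.isNumericalSemigroup, hasMultiplicity_semigroupRing
      ?_ (by omega) (fun h hh h0 => ?_) hc,
      hm.isSemidualizingShift.hasNontrivialSemidualizingModule ?_
        (hm.socle_notMem (r := 1) (by omega)) (hm.socle_notMem (r := 2) (by omega))
        (hm.socle_add_mem (by omega) (fun i h h' => ?_) fun i h h' => ?_)
        (hm.socle_add_mem (by omega) (fun i h h' => ?_) fun i h h' => ?_)⟩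
    · rcases Nat.eq_zero_or_pos j with rfl | hj0
      · exact hm.mul_mem_semigroup le_rfl
      -- For j > 0 the multiplicity is attained in class p - j, the first with value 2.
      · rw [hm.mem_semigroup, show 3 * p - j = (p - j) + 2 * p by omega,
          Nat.add_mul_div_right _ _ hm.pos, Nat.add_mul_mod_self_right,
          Nat.mod_eq_of_lt (by omega), Nat.div_eq_of_lt (by omega)]
        split_ifs <;> omega
    · have hdm := Nat.div_add_mod h p
      have hlt := Nat.mod_lt h hm.pos
      rw [hm.mem_semigroup] at hh
      have hmul {i : ℕ} (hi : i ≤ h / p) : p * i ≤ p * (h / p) := Nat.mul_le_mul_left p hi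
      split_ifs at hh with h2 h3
      · have : h / p ≠ 0 := fun h3 => h0 (by rw [← hdm, h2, h3, mul_zero])
        have := hmul (i := 3) (by omega)
        omega
      · have := hmul (i := 5) (by omega)
        omega
      · have := hmul (i := 2) (by omega)
        omega
    · rw [h1 (by decide) (by omega), h1 (by decide) (by omega)]
      omega
    all_goals split_ifs <;> first | omega | contradiction
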